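/- Let $(b_k,e_k)_{k\ge 0}$ be independent, identically distributed random vectors in $\mathbb{R}^2$ with $$E b_0=0,\quad E b_0^2=\omega^2\in(0,\infty),\quad E e_0=0,\quad E e_0^2=\sigma^2\in(0,\infty),\quad \operatorname{cov}(b_0,e_0)=0,$$ let $\varphi\in\mathbb{R}$ and assume $E\log|\varphi+b_0|\ge 0$ (with $\log 0=-\infty$, so that in particular $P(\varphi+b_0=0)=0$). Let $X_0$ be a constant and $$X_k=(\varphi+b_k)X_{k-1}+e_k,\qquad k\ge 1.$$ For $s\in\mathbb{R}$, $x>0$, $y>0$ let $$L_n(s,x,y)=-\frac12\sum_{k=1}^n\left(\log(xX_{k-1}^2+y)+\frac{(X_k-sX_{k-1})^2}{xX_{k-1}^2+y}\right).$$ Let $\Gamma=[s_*,s^*]\times[x_*,x^*]$ with $s_*<s^*$ and $0<x_*<x^*$, and assume $(\varphi,\omega^2)\in\Gamma$. For $y>0$ let the quasi-maximum likelihood estimator $\widehat{\eta}_n(y)$ be any maximizer of $(s,x)\mapsto L_n(s,x,y)$ over $\Gamma$. Then, for every fixed $y>0$, $$\widehat{\eta}_n(y)\longrightarrow(\varphi,\omega^2)\quad\text{in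 probability as } n\to\infty.$$ -/

import Mathlib

open MeasureTheory ProbabilityTheory Filter Topology

/-- The random coefficient autoregression `X_k = (φ + b_k) X_{k-1} + e_k`, `k ≥ 1`, started from
the constant `X_0 = x₀`. -/
def rcaProcess {Ω : Type*} (φ x₀ : ℝ) (b e : ℕ → Ω → ℝ) : ℕ → Ω → ℝ
  | 0, _ => x₀
  | k + 1, o => (φ + b (k + 1) o) * rcaProcess φ x₀ b e k o + e (k + 1) o

/-- One term of the Gaussian quasi-log-likelihood (constants omitted), where `v` is the previous
observation and `u` is the current one:
`-(1/2) (log (x v² + y) + (u - s v)² / (x v² + y))`. -/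
noncomputable def qlTerm (s x y v u : ℝ) : ℝ :=
  -(1 / 2) * (Real.log (x * v ^ 2 + y) + (u - s * v) ^ 2 / (x * v ^ 2 + y))

/-- The Gaussian conditional quasi-log-likelihood
`L_n(s, x, y) = ∑_{k=1}^n ℓ_k(s, x, y)` of a path `X 0, …, X n`
(the summand with index `k` here is `ℓ_{k+1}`). -/
noncomputable def quasiLogLik (X : ℕ → ℝ) (n : ℕ) (s x y : ℝ) : ℝ :=
  ∑ k ∈ Finset.range n, qlTerm s x y (X k) (X (k + 1))

/-- `z` is a value of the quasi-maximum likelihood estimator of `(φ, ω²)` over `Γ`, for the third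
argument `y`: a maximizer over `Γ` of `(s, x) ↦ L_n(s, x, y)`. -/
def IsQMLE (X : ℕ → ℝ) (n : ℕ) (y : ℝ) (Γ : Set (ℝ × ℝ)) (z : ℝ × ℝ) : Prop :=
  z ∈ Γ ∧ IsMaxOn (fun q : ℝ × ℝ => quasiLogLik X n q.1 q.2 y) Γ z

/-! When `|X_k|` is large, `-2 ℓ_{k+1}(s, x, y)` is `log (1 + X_k²)`, which is free of the
parameter, plus `log x + (φ - s + b_{k+1})² / x`, up to an error of order `1 / (1 + |X_k|)` that is
uniform over `Γ`; neither `y` nor `σ²` enters the main term. If the chain is rarely in compact sets,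
then by the law of large numbers the normalised contrast converges uniformly to `limitContrast`,
whose only minimum is at `(φ, ω²)`, and consistency follows.

The core is `tendsto_cesaro_of_affine_recursion`: time averages of the laws of `X_k` lose all their
mass at infinity. A nonzero vague limit would, once normalised, be an invariant probability `ν` of
`x ↦ A x + B` with `E log |A| ≥ 0`. Invariance and Jensen give `|ν̂(t)|² ≤ E |ν̂(tA)|²`. The
Gaussian average of `|ν̂(r ·)|²` is nonincreasing in `r ≥ 0`, so in the variable `log r` it is a
bounded monotone function that is subharmonic for a step of nonnegative mean. By
`antitone_subharmonic_eq` it is harmonic, and equality holds in Jensen: almost every single map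
preserves `ν`. Hence all of these maps share a fixed point (`exists_fixedPoint_of_invariant`), which
zero covariance and `σ² > 0` exclude (`not_exists_fixedPoint`). -/

/-! ### Equality in Jensen's inequality; bounded monotone subharmonic functions -/

section Jensen

variable {Ω : Type*} [MeasurableSpace Ω] {P : Measure Ω}

theorem integral_norm_sub_integral_sq [IsProbabilityMeasure P] {Y : Ω → ℂ}
    (hY : AEStronglyMeasurable Y P) (hb : ∀ o, ‖Y o‖ ≤ 1) :
    ∫ o, ‖Y o - ∫ o', Y o' ∂P‖ ^ 2 ∂P = ∫ o, ‖Y o‖ ^ 2 ∂P - ‖∫ o, Y o ∂P‖ ^ 2 := by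
  have hi : Integrable Y P := Integrable.of_bound hY 1 (.of_forall hb)
  have hi2 : Integrable (fun o => ‖Y o‖ ^ 2) P :=
    Integrable.of_bound (hY.norm.pow 2) 1 (.of_forall fun o => by
      rw [Real.norm_of_nonneg (by positivity)]
      exact pow_le_one₀ (norm_nonneg _) (hb o))
  set m := ∫ o, Y o ∂P with hm
  have h1 : ∀ o, ‖Y o - m‖ ^ 2 = ‖Y o‖ ^ 2 - 2 * inner ℝ m (Y o) + ‖m‖ ^ 2 := fun o => by
    rw [norm_sub_sq_real, real_inner_comm]
  have hin : Integrable (fun o => inner ℝ m (Y o)) P := hi.const_inner m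
  have hi3 : Integrable (fun o => ‖Y o‖ ^ 2 - 2 * inner ℝ m (Y o)) P := hi2.sub (hin.const_mul 2)
  simp_rw [h1]
  rw [integral_add hi3 (integrable_const _), integral_sub hi2 (hin.const_mul 2),
    integral_const_mul, integral_inner hi m, ← hm,
    real_inner_self_eq_norm_sq]
  simp
  ring

/-- A bounded complex random variable attaining equality in Jensen's inequality for the squared
modulus is almost surely constant. -/
theorem ae_eq_integral_of_integral_norm_sq_le [IsProbabilityMeasure P] {Y : Ω → ℂ}
    (hY : AEStronglyMeasurable Y P) (hb : ∀ o, ‖Y o‖ ≤ 1) (h : ∫ o, ‖Y o‖ ^ 2 ∂P ≤ ‖∫ o, Y o ∂P‖ ^ 2) :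
    ∀ᵐ o ∂P, Y o = ∫ o', Y o' ∂P := by
  have h0 := integral_norm_sub_integral_sq hY hb
  set m := ∫ o, Y o ∂P
  have hi : Integrable (fun o => ‖Y o - m‖ ^ 2) P :=
    Integrable.of_bound ((hY.sub aestronglyMeasurable_const).norm.pow 2) ((1 + ‖m‖) ^ 2)
      (.of_forall fun o => by
        rw [Real.norm_of_nonneg (by positivity)]
        have := norm_sub_le (Y o) m
        have := hb o
        gcongr
        linarith)
  have h1 : ∫ o, ‖Y o - m‖ ^ 2 ∂P = 0 :=
    le_antisymm (by rw [h0]; linarith) (integral_nonneg fun o => by positivity)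
  rw [integral_eq_zero_iff_of_nonneg (fun o => by positivity) hi] at h1
  filter_upwards [h1] with o ho
  simpa [sub_eq_zero] using ho

theorem norm_integral_sq_le [IsProbabilityMeasure P] {Y : Ω → ℂ}
    (hY : AEStronglyMeasurable Y P) (hb : ∀ o, ‖Y o‖ ≤ 1) : ‖∫ o, Y o ∂P‖ ^ 2 ≤ ∫ o, ‖Y o‖ ^ 2 ∂P := by
  have h0 := integral_norm_sub_integral_sq hY hb
  have : 0 ≤ ∫ o, ‖Y o - ∫ o', Y o' ∂P‖ ^ 2 ∂P := integral_nonneg fun o => by positivity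
  linarith

/-- Continuous families of almost sure identities hold almost surely for all parameters. -/
theorem ae_forall_eq_of_forall_ae_eq {f g : Ω → ℝ → ℂ} (hf : ∀ o, Continuous (f o))
    (hg : ∀ o, Continuous (g o)) (h : ∀ t, ∀ᵐ o ∂P, f o t = g o t) :
    ∀ᵐ o ∂P, ∀ t, f o t = g o t := by
  have : ∀ᵐ o ∂P, ∀ q : ℚ, f o q = g o q := ae_all_iff.2 fun q => h q
  filter_upwards [this] with o ho t
  exact congrFun (Continuous.ext_on Rat.denseRange_cast (hf o) (hg o) (by
    rintro _ ⟨q, rfl⟩; exact ho q)) t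

/-- Differentiate at `t = 0`. Only small `t` are assumed because the identity is obtained by
cancelling a characteristic function, which may vanish away from `0`. -/
theorem eq_of_eventually_exp_eq {x y : ℝ}
    (h : ∀ᶠ t : ℝ in 𝓝 0, Complex.exp (t * x * Complex.I) = Complex.exp (t * y * Complex.I)) :
    x = y := by
  have h1 : (fun t : ℝ => Complex.exp (t * x * Complex.I)) =ᶠ[𝓝 0]
    fun t : ℝ => Complex.exp (t * y * Complex.I) := h
  have hd : ∀ z : ℝ, HasDerivAt (fun t : ℝ => Complex.exp (t * z * Complex.I))
      (z * Complex.I) 0 := fun z => by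
    have h2 : HasDerivAt (fun t : ℝ => (t : ℂ)) 1 (0 : ℝ) := Complex.ofRealCLM.hasDerivAt
    have := ((h2.mul_const (z : ℂ)).mul_const Complex.I).cexp
    simpa using this
  have := (hd x).unique ((hd y).congr_of_eventuallyEq h1)
  simpa using this

/-- A bounded nonincreasing continuous function which is subharmonic for an integrable step of
nonnegative mean is harmonic. -/
theorem antitone_subharmonic_eq [IsProbabilityMeasure P] {G : ℝ → ℝ} (hG : Antitone G)
    (hc : Continuous G) (h0 : ∀ u, 0 ≤ G u) (h1 : ∀ u, G u ≤ 1) {ξ : Ω → ℝ} (hm : Measurable ξ) (hξ : Integrable ξ P)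
    (hmean : 0 ≤ ∫ o, ξ o ∂P) (hsub : ∀ u, G u ≤ ∫ o, G (u + ξ o) ∂P) (u : ℝ) :
    ∫ o, G (u + ξ o) ∂P = G u := by
  have habs : ∀ u, |G u| ≤ 1 := fun u => abs_le.2 ⟨by linarith [h0 u], h1 u⟩
  have hint : ∀ u, Integrable (fun o => G (u + ξ o)) P := fun u =>
    Integrable.of_bound (hc.measurable.comp (hm.const_add u)).aestronglyMeasurable 1
      (.of_forall fun o => habs _)
  set H : ℝ → ℝ := fun u => ∫ o, (G (u + ξ o) - G u) ∂P with hH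
  have hHe : ∀ u, H u = ∫ o, G (u + ξ o) ∂P - G u := fun u => by
    simp [hH, integral_sub (hint u) (integrable_const _)]
  have hH0 : ∀ u, 0 ≤ H u := fun u => by rw [hHe]; linarith [hsub u]
  have hHc : Continuous H := by
    apply continuous_of_dominated (bound := fun _ => 2)
    · intro u
      exact ((hint u).sub (integrable_const _)).aestronglyMeasurable
    · intro u
      refine .of_forall fun o => ?_
      have := habs (u + ξ o)
      have := habs u
      exact (norm_sub_le _ _).trans (by simp only [Real.norm_eq_abs]; linarith)
    · exact integrable_const _
    · exact .of_forall fun o => by fun_prop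
  have hii : ∀ a b, IntervalIntegrable G volume a b := fun a b => hc.intervalIntegrable a b
  -- Shifting `[-N, N]` by `ξ` changes the integral of `G` only near the two endpoints.
  have hT : ∀ N : ℝ, ∫ u in (-N)..N, H u =
      ∫ o, (∫ v in (0 : ℝ)..ξ o, (G (N + v) - G (-N + v))) ∂P := by
    intro N
    have : ∫ u in (-N)..N, H u = ∫ o, (∫ u in (-N)..N, (G (u + ξ o) - G u)) ∂P := by
      simp only [hH]
      have hfin : IsFiniteMeasure ((volume : Measure ℝ).restrict (Set.uIoc (-N) N)) :=
        ⟨by rw [Measure.restrict_apply_univ, Set.uIoc]; exact measure_Ioc_lt_top⟩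
      apply intervalIntegral_integral_swap
      refine Integrable.of_bound (C := 2) ?_ (.of_forall fun p => ?_)
      · refine Measurable.aestronglyMeasurable ?_
        exact (hc.measurable.comp (measurable_fst.add (hm.comp measurable_snd))).sub
          (hc.measurable.comp measurable_fst)
      · have := habs (p.1 + ξ p.2)
        have := habs p.1
        exact (norm_sub_le _ _).trans (by simp only [Real.norm_eq_abs]; linarith)
    rw [this]
    refine integral_congr_ae (.of_forall fun o => ?_)
    simp only
    rw [intervalIntegral.integral_sub
      ((by fun_prop : Continuous fun u => G (u + ξ o)).intervalIntegrable _ _) (hii _ _),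
      intervalIntegral.integral_sub
      ((by fun_prop : Continuous fun v => G (N + v)).intervalIntegrable _ _)
      ((by fun_prop : Continuous fun v => G (-N + v)).intervalIntegrable _ _),
      intervalIntegral.integral_comp_add_right, intervalIntegral.integral_comp_add_left,
      intervalIntegral.integral_comp_add_left]
    have e1 := intervalIntegral.integral_add_adjacent_intervals (hii (-N + ξ o) N) (hii N (N + ξ o))
    have e2 := intervalIntegral.integral_add_adjacent_intervals
      (hii (-N) (-N + ξ o)) (hii (-N + ξ o) N)
    simp only [add_zero]
    linarith
  obtain ⟨Lp, hLp⟩ : ∃ l, Tendsto G atTop (𝓝 l) :=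
    ⟨_, tendsto_atTop_ciInf hG ⟨0, by rintro _ ⟨u, rfl⟩; exact h0 u⟩⟩
  obtain ⟨Lm, hLm⟩ : ∃ l, Tendsto G atBot (𝓝 l) :=
    ⟨_, tendsto_atBot_ciSup hG ⟨1, by rintro _ ⟨u, rfl⟩; exact h1 u⟩⟩
  have hle : Lp ≤ Lm := (hG.le_of_tendsto hLp 0).trans (hG.ge_of_tendsto hLm 0)
  -- Near the endpoints `G` is close to its limits `Lp ≤ Lm`, so the total integral of `H ≥ 0` is
  -- `(Lp - Lm) E ξ ≤ 0`. Integrability of `ξ` supplies the dominating function.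
  have hlim : Tendsto (fun N : ℝ => ∫ u in (-N)..N, H u) atTop (𝓝 (∫ o, ξ o * (Lp - Lm) ∂P)) := by
    simp_rw [hT]
    refine tendsto_integral_filter_of_dominated_convergence (fun o => 2 * |ξ o|) ?_ ?_ ?_ ?_
    · refine .of_forall fun N => ?_
      have hcont : Continuous fun x : ℝ => ∫ v in (0 : ℝ)..x, (G (N + v) - G (-N + v)) :=
        intervalIntegral.continuous_primitive (fun a b =>
          (by fun_prop : Continuous fun v => G (N + v) - G (-N + v)).intervalIntegrable a b) 0
      exact (hcont.measurable.comp hm).aestronglyMeasurable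
    · refine .of_forall fun N => .of_forall fun o => ?_
      have := intervalIntegral.norm_integral_le_of_norm_le_const (a := 0) (b := ξ o) (C := 2)
        (f := fun v => G (N + v) - G (-N + v)) (fun v _ => by
          have := habs (N + v)
          have := habs (-N + v)
          exact (norm_sub_le _ _).trans (by simp only [Real.norm_eq_abs]; linarith))
      simpa using this
    · exact hξ.abs.const_mul 2
    · refine .of_forall fun o => ?_
      have : ξ o * (Lp - Lm) = ∫ v in (0 : ℝ)..ξ o, (Lp - Lm) := by
        rw [intervalIntegral.integral_const]; simp
      rw [this]
      refine intervalIntegral.tendsto_integral_filter_of_dominated_convergence (fun _ => 2)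
        ?_ ?_ ?_ ?_
      · exact .of_forall fun N =>
          (by fun_prop : Continuous fun v => G (N + v) - G (-N + v)).aestronglyMeasurable
      · refine .of_forall fun N => .of_forall fun v _ => ?_
        have := habs (N + v)
        have := habs (-N + v)
        exact (norm_sub_le _ _).trans (by simp only [Real.norm_eq_abs]; linarith)
      · simp
      · refine .of_forall fun v _ => ?_
        refine (hLp.comp (tendsto_atTop_add_const_right _ v tendsto_id)).sub
          (hLm.comp (tendsto_atBot_add_const_right _ v tendsto_neg_atTop_atBot))
  have hneg : ∫ o, ξ o * (Lp - Lm) ∂P ≤ 0 := by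
    rw [integral_mul_const]
    exact mul_nonpos_of_nonneg_of_nonpos hmean (by linarith)
  have hmono : ∀ M N : ℝ, 0 ≤ M → M ≤ N → ∫ u in (-M)..M, H u ≤ ∫ u in (-N)..N, H u := by
    intro M N hM hMN
    refine intervalIntegral.integral_mono_interval (by linarith) (by linarith) hMN
      (.of_forall hH0) (hHc.intervalIntegrable _ _)
  have hzero : ∫ u in (-(|u| + 1))..(|u| + 1), H u ≤ 0 :=
    (ge_of_tendsto hlim ((eventually_ge_atTop (|u| + 1)).mono fun N hN =>
      hmono _ N (by positivity) hN)).trans hneg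
  by_contra hne
  have hpos : 0 < H u := lt_of_le_of_ne (hH0 u) (by rw [hHe]; intro h; apply hne; linarith)
  have hu := abs_lt.1 (lt_add_one |u|)
  have := intervalIntegral.integral_pos (a := -(|u| + 1)) (b := |u| + 1) (f := H)
    (by linarith [abs_nonneg u]) hHc.continuousOn (fun x _ => hH0 x) ⟨u, ⟨hu.1.le, hu.2.le⟩, hpos⟩
  linarith

end Jensen

/-! ### Characteristic functions and their Gaussian energy -/

section CharFun

variable {ν : Measure ℝ} [IsProbabilityMeasure ν]

theorem continuous_charFun_real : Continuous (charFun ν) := by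
  have : charFun ν = fun t : ℝ => ∫ x, Complex.exp (t * x * Complex.I) ∂ν :=
    funext fun t => charFun_apply_real t
  rw [this]
  refine continuous_of_dominated (bound := fun _ => 1) (fun t => ?_) (fun t => ?_)
    (integrable_const _) ?_
  · exact (by fun_prop : Continuous fun x : ℝ =>
      Complex.exp (t * x * Complex.I)).aestronglyMeasurable
  · refine .of_forall fun x => le_of_eq ?_
    rw [← Complex.ofReal_mul, Complex.norm_exp_ofReal_mul_I]
  · exact .of_forall fun x => by fun_prop

/-- The squared modulus is the characteristic function of the difference of two independent copies.
-/
theorem norm_sq_charFun_eq (t : ℝ) :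
    ((‖charFun ν t‖ ^ 2 : ℝ) : ℂ) =
      ∫ p : ℝ × ℝ, Complex.exp (t * (p.1 - p.2 : ℝ) * Complex.I) ∂ν.prod ν := by
  have h : ∀ p : ℝ × ℝ, Complex.exp (t * (p.1 - p.2 : ℝ) * Complex.I) =
      Complex.exp (t * p.1 * Complex.I) * Complex.exp ((-t : ℝ) * p.2 * Complex.I) := fun p => by
    rw [← Complex.exp_add]; congr 1; push_cast; ring
  simp_rw [h]
  rw [integral_prod_mul (fun x : ℝ => Complex.exp (t * x * Complex.I))
    (fun x : ℝ => Complex.exp ((-t : ℝ) * x * Complex.I)), ← charFun_apply_real,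
    ← charFun_apply_real, charFun_neg, Complex.mul_conj']
  push_cast; rfl

variable (ν) in
/-- The Gaussian average of the squared modulus of the characteristic function at scale `r`. -/
noncomputable def charEnergy (r : ℝ) : ℝ := ∫ s, ‖charFun ν (r * s)‖ ^ 2 ∂gaussianReal 0 1

/-- Fubini: integrating the Gaussian variable first leaves its own characteristic function. This
form makes monotonicity in `|r|` visible, whereas `‖charFun ν‖` itself need not be monotone. -/
theorem charEnergy_eq (r : ℝ) :
    charEnergy ν r = ∫ p : ℝ × ℝ, Real.exp (-(r * (p.1 - p.2)) ^ 2 / 2) ∂ν.prod ν := by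
  have h : ((charEnergy ν r : ℝ) : ℂ) =
      ((∫ p : ℝ × ℝ, Real.exp (-(r * (p.1 - p.2)) ^ 2 / 2) ∂ν.prod ν : ℝ) : ℂ) := by
    rw [charEnergy, ← integral_complex_ofReal, ← integral_complex_ofReal]
    simp_rw [norm_sq_charFun_eq]
    rw [integral_integral_swap]
    · refine integral_congr_ae (.of_forall fun p => ?_)
      have := charFun_gaussianReal (μ := 0) (v := 1) (r * (p.1 - p.2))
      rw [charFun_apply_real] at this
      simp only
      convert this using 1
      · refine integral_congr_ae (.of_forall fun s => ?_)
        simp only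
        congr 1; push_cast; ring
      · push_cast; congr 1; simp; ring
    · refine Integrable.of_bound (C := 1) ?_ (.of_forall fun p => le_of_eq ?_)
      · exact (by fun_prop : Continuous fun q : ℝ × ℝ × ℝ =>
          Complex.exp ((r * q.1 : ℝ) * (q.2.1 - q.2.2 : ℝ) * Complex.I)).aestronglyMeasurable
      · simp only [Function.uncurry]
        rw [← Complex.ofReal_mul, Complex.norm_exp_ofReal_mul_I]
  exact_mod_cast h

theorem exp_neg_sq_le_one (z : ℝ) : Real.exp (-z ^ 2 / 2) ≤ 1 :=
  Real.exp_le_one_iff.2 (by nlinarith [sq_nonneg z])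

theorem integrable_exp_neg_sq (r : ℝ) :
    Integrable (fun p : ℝ × ℝ => Real.exp (-(r * (p.1 - p.2)) ^ 2 / 2)) (ν.prod ν) :=
  Integrable.of_bound (by fun_prop : Continuous fun p : ℝ × ℝ =>
    Real.exp (-(r * (p.1 - p.2)) ^ 2 / 2)).aestronglyMeasurable 1 (.of_forall fun p => by
      rw [Real.norm_of_nonneg (Real.exp_nonneg _)]; exact exp_neg_sq_le_one _)

theorem charEnergy_nonneg {ν : Measure ℝ} (r : ℝ) : 0 ≤ charEnergy ν r :=
  integral_nonneg fun _ => by positivity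

theorem charEnergy_le_one (r : ℝ) : charEnergy ν r ≤ 1 := by
  rw [charEnergy_eq]
  calc _ ≤ ∫ p : ℝ × ℝ, (1 : ℝ) ∂ν.prod ν :=
        integral_mono (integrable_exp_neg_sq r) (integrable_const _) fun p => exp_neg_sq_le_one _
    _ = 1 := by simp

theorem continuous_charEnergy : Continuous (charEnergy ν) := by
  have : charEnergy ν = fun r => ∫ p : ℝ × ℝ, Real.exp (-(r * (p.1 - p.2)) ^ 2 / 2) ∂ν.prod ν :=
    funext charEnergy_eq
  rw [this]
  refine continuous_of_dominated (bound := fun _ => 1)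
    (fun r => (integrable_exp_neg_sq r).aestronglyMeasurable) (fun r => .of_forall fun p => ?_)
    (integrable_const _) (.of_forall fun p => by fun_prop)
  rw [Real.norm_of_nonneg (Real.exp_nonneg _)]; exact exp_neg_sq_le_one _

theorem charEnergy_anti {r r' : ℝ} (h0 : 0 ≤ r) (h : r ≤ r') :
    charEnergy ν r' ≤ charEnergy ν r := by
  rw [charEnergy_eq, charEnergy_eq]
  refine integral_mono (integrable_exp_neg_sq _) (integrable_exp_neg_sq _) fun p => ?_
  simp only
  apply Real.exp_le_exp.2
  have : r ^ 2 ≤ r' ^ 2 := by gcongr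
  have := mul_le_mul_of_nonneg_right this (sq_nonneg (p.1 - p.2))
  rw [mul_pow, mul_pow]
  linarith

theorem charEnergy_abs (r : ℝ) : charEnergy ν |r| = charEnergy ν r := by
  simp_rw [charEnergy_eq, mul_pow, sq_abs]

/-- A probability measure whose characteristic function has modulus one is a point mass. -/
theorem exists_charFun_eq_exp (h : ∀ t, ‖charFun ν t‖ = 1) :
    ∃ c : ℝ, ∀ t : ℝ, charFun ν t = Complex.exp (t * c * Complex.I) := by
  have key : ∀ᵐ x : ℝ ∂ν, ∀ t : ℝ, Complex.exp (t * x * Complex.I) = charFun ν t := by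
    refine ae_forall_eq_of_forall_ae_eq (fun x => by fun_prop)
      (fun _ => continuous_charFun_real) fun t => ?_
    have hn : ∀ x : ℝ, ‖Complex.exp (t * x * Complex.I)‖ = 1 := fun x => by
      rw [← Complex.ofReal_mul, Complex.norm_exp_ofReal_mul_I]
    have := ae_eq_integral_of_integral_norm_sq_le (P := ν)
      (Y := fun x : ℝ => Complex.exp (t * x * Complex.I))
      (by fun_prop : Continuous fun x : ℝ => Complex.exp (t * x * Complex.I)).aestronglyMeasurable
      (fun x => (hn x).le) (by simp_rw [hn]; rw [← charFun_apply_real, h]; simp)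
    rwa [← charFun_apply_real] at this
  obtain ⟨c, hc⟩ := key.exists
  exact ⟨c, fun t => (hc t).symm⟩

/-- An affine image of `ν` can only equal `ν` if the slope is `±1`, unless `ν` is a point mass. -/
theorem abs_slope_eq_one_of_charFun_eq {a b : ℝ} (ha : a ≠ 0)
    (h : ∀ t : ℝ, Complex.exp (t * b * Complex.I) * charFun ν (t * a) = charFun ν t)
    (hnd : ¬ ∀ t, ‖charFun ν t‖ = 1) : |a| = 1 := by
  have h1 : ∀ t, ‖charFun ν (t * a)‖ = ‖charFun ν t‖ := fun t => by
    rw [← h t, norm_mul, ← Complex.ofReal_mul, Complex.norm_exp_ofReal_mul_I, one_mul]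
  -- Iterating the contraction brings the argument to `0`, where the modulus is `1`. An expanding
  -- slope is handled through its inverse.
  have key : ∀ q : ℝ, |q| < 1 → (∀ t, ‖charFun ν (t * q)‖ = ‖charFun ν t‖) → False := by
    intro q hq hqe
    apply hnd
    intro t
    have hpow : ∀ n : ℕ, ‖charFun ν (t * q ^ n)‖ = ‖charFun ν t‖ := by
      intro n
      induction n with
      | zero => simp
      | succ n ih => rw [pow_succ, ← mul_assoc, hqe, ih]
    have hl : Tendsto (fun n : ℕ => ‖charFun ν (t * q ^ n)‖) atTop (𝓝 ‖charFun ν (t * 0)‖) :=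
      ((continuous_charFun_real.norm.tendsto _)).comp
        ((tendsto_pow_atTop_nhds_zero_of_abs_lt_one hq).const_mul t)
    simp_rw [hpow] at hl
    have := tendsto_nhds_unique hl tendsto_const_nhds
    rw [← this]; simp
  rcases lt_trichotomy |a| 1 with hlt | heq | hgt
  · exact (key a hlt h1).elim
  · exact heq
  · refine (key a⁻¹ ?_ fun t => ?_).elim
    · rw [abs_inv]; exact inv_lt_one_of_one_lt₀ hgt
    · rw [← h1 (t * a⁻¹)]; congr 2; field_simp

end CharFun

/-! ### Invariant probabilities of random affine maps -/

section InvariantMeasure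

variable {Ω : Type*} [MeasurableSpace Ω] {P : Measure Ω} [IsProbabilityMeasure P]
  {ν : Measure ℝ} [IsProbabilityMeasure ν] {A B : Ω → ℝ}

theorem charFun_eq_of_invariant (hA : Measurable A) (hB : Measurable B)
    (hν : (ν.prod P).map (fun p => A p.2 * p.1 + B p.2) = ν) (t : ℝ) :
    charFun ν t = ∫ o, Complex.exp (t * B o * Complex.I) * charFun ν (t * A o) ∂P := by
  have hm : Measurable fun p : ℝ × Ω => A p.2 * p.1 + B p.2 := by fun_prop
  have hc : Continuous fun x : ℝ => Complex.exp (t * x * Complex.I) := by fun_prop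
  conv_lhs => rw [← hν]
  rw [charFun_apply_real, integral_map hm.aemeasurable hc.aestronglyMeasurable,
    integral_prod_symm]
  · refine integral_congr_ae (.of_forall fun o => ?_)
    simp only
    rw [charFun_apply_real, ← integral_const_mul]
    refine integral_congr_ae (.of_forall fun x => ?_)
    simp only
    rw [← Complex.exp_add]; congr 1; push_cast; ring
  · refine Integrable.of_bound (hc.measurable.comp hm).aestronglyMeasurable 1
      (.of_forall fun p => le_of_eq ?_)
    rw [← Complex.ofReal_mul, Complex.norm_exp_ofReal_mul_I]

/-- Averaging over the maps loses nothing: equality in Jensen means that almost every single map `x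
↦ A x + B` preserves `ν`. -/
theorem ae_charFun_affine_eq (hA : Measurable A) (hB : Measurable B)
    (hne : ∀ᵐ o ∂P, A o ≠ 0) (hint : Integrable (fun o => Real.log |A o|) P)
    (hlog : 0 ≤ ∫ o, Real.log |A o| ∂P)
    (hν : (ν.prod P).map (fun p => A p.2 * p.1 + B p.2) = ν) :
    ∀ᵐ o ∂P, ∀ t : ℝ, Complex.exp (t * B o * Complex.I) * charFun ν (t * A o) = charFun ν t := by
  have hcc : Continuous (charFun ν) := continuous_charFun_real
  have hinv := charFun_eq_of_invariant hA hB hν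
  have hYm : ∀ t : ℝ, AEStronglyMeasurable
      (fun o => Complex.exp (t * B o * Complex.I) * charFun ν (t * A o)) P := fun t => by
    have := hcc.measurable
    exact Measurable.aestronglyMeasurable (by fun_prop)
  have hYn : ∀ (t : ℝ) o, ‖Complex.exp (t * B o * Complex.I) * charFun ν (t * A o)‖ =
      ‖charFun ν (t * A o)‖ := fun t o => by
    rw [norm_mul, ← Complex.ofReal_mul, Complex.norm_exp_ofReal_mul_I, one_mul]
  have hYb : ∀ (t : ℝ) o, ‖Complex.exp (t * B o * Complex.I) * charFun ν (t * A o)‖ ≤ 1 :=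
    fun t o => by rw [hYn]; exact norm_charFun_le_one _
  set K : ℝ → ℝ := fun t => ∫ o, ‖charFun ν (t * A o)‖ ^ 2 ∂P with hK
  have hsq : ∀ t, ‖charFun ν t‖ ^ 2 ≤ 1 := fun t =>
    pow_le_one₀ (norm_nonneg _) (norm_charFun_le_one _)
  have hsqc : Continuous fun t => ‖charFun ν t‖ ^ 2 := hcc.norm.pow 2
  have hle : ∀ t, ‖charFun ν t‖ ^ 2 ≤ K t := fun t => by
    have := norm_integral_sq_le (hYm t) (hYb t)
    rw [← hinv t] at this
    simpa only [hYn] using this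
  have hKc : Continuous K := by
    refine continuous_of_dominated (bound := fun _ => 1) (fun t => ?_)
      (fun t => .of_forall fun o => ?_) (integrable_const _) (.of_forall fun o => ?_)
    · exact (hsqc.measurable.comp (hA.const_mul t)).aestronglyMeasurable
    · rw [Real.norm_of_nonneg (by positivity)]; exact hsq _
    · exact hsqc.comp (continuous_mul_const _)
  have hK1 : ∀ t, K t ≤ 1 := fun t => by
    calc K t ≤ ∫ o, (1 : ℝ) ∂P := integral_mono_of_nonneg (.of_forall fun o => by positivity)
          (integrable_const _) (.of_forall fun o => hsq _)
      _ = 1 := by simp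
  have hKn : ∀ t, 0 ≤ K t := fun t => (by positivity : (0:ℝ) ≤ ‖charFun ν t‖ ^ 2).trans (hle t)
  have hKi : ∀ r, Integrable (fun s => K (r * s)) (gaussianReal 0 1) := fun r =>
    Integrable.of_bound (hKc.comp (continuous_const_mul r)).aestronglyMeasurable 1
      (.of_forall fun s => by rw [Real.norm_of_nonneg (hKn _)]; exact hK1 _)
  have hCi : ∀ r, Integrable (fun s => ‖charFun ν (r * s)‖ ^ 2) (gaussianReal 0 1) := fun r =>
    Integrable.of_bound (hsqc.comp (continuous_const_mul r)).aestronglyMeasurable 1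
      (.of_forall fun s => by rw [Real.norm_of_nonneg (by positivity)]; exact hsq _)
  have hswap : ∀ r, ∫ s, K (r * s) ∂gaussianReal 0 1 = ∫ o, charEnergy ν (r * A o) ∂P := by
    intro r
    simp only [hK, charEnergy]
    rw [integral_integral_swap]
    · simp only [mul_right_comm]
    · refine Integrable.of_bound (C := 1) ?_ (.of_forall fun p => ?_)
      · exact (hsqc.measurable.comp ((measurable_fst.const_mul r).mul
          (hA.comp measurable_snd))).aestronglyMeasurable
      · simp only [Function.uncurry]
        rw [Real.norm_of_nonneg (by positivity)]; exact hsq _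
  have hsub : ∀ r, charEnergy ν r ≤ ∫ o, charEnergy ν (r * A o) ∂P := fun r => by
    rw [← hswap]
    exact integral_mono (hCi r) (hKi r) fun s => hle _
  -- With `r = exp u`, multiplication by `|A|` becomes the additive step `log |A|`; the energy is
  -- even, so the sign of `A` is irrelevant.
  have hexp : ∀ u, ∫ o, charEnergy ν (Real.exp (u + Real.log |A o|)) ∂P =
      ∫ o, charEnergy ν (Real.exp u * A o) ∂P := fun u => by
    refine integral_congr_ae ?_
    filter_upwards [hne] with o ho
    rw [Real.exp_add, Real.exp_log (abs_pos.2 ho), ← charEnergy_abs (Real.exp u * A o), abs_mul,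
      abs_of_pos (Real.exp_pos u)]
  have heq := antitone_subharmonic_eq (P := P) (G := fun u => charEnergy ν (Real.exp u))
    (fun u v huv => charEnergy_anti (Real.exp_nonneg _) (Real.exp_le_exp.2 huv))
    (continuous_charEnergy.comp Real.continuous_exp) (fun u => charEnergy_nonneg _)
    (fun u => charEnergy_le_one _) (hA.abs.log) hint hlog
    (fun u => by rw [hexp]; exact hsub _) 0
  rw [hexp, Real.exp_zero, ← hswap] at heq
  have hzero : ∫ s, (K (1 * s) - ‖charFun ν (1 * s)‖ ^ 2) ∂gaussianReal 0 1 = 0 := by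
    rw [integral_sub (hKi 1) (hCi 1), heq, charEnergy, sub_self]
  rw [integral_eq_zero_iff_of_nonneg (fun s => sub_nonneg.2 (hle _)) ((hKi 1).sub (hCi 1))] at hzero
  -- Scale `r = 1` suffices: Lebesgue measure is absolutely continuous with respect to the Gaussian,
  -- and continuity upgrades almost everywhere to everywhere.
  have hvol : (fun s => K (1 * s) - ‖charFun ν (1 * s)‖ ^ 2) =ᵐ[volume] 0 :=
    (gaussianReal_absolutelyContinuous' 0 one_ne_zero).ae_eq hzero
  have hall : ∀ s, K s = ‖charFun ν s‖ ^ 2 := fun s => by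
    have : K (1 * s) - ‖charFun ν (1 * s)‖ ^ 2 = 0 :=
      congrFun ((Continuous.ae_eq_iff_eq volume (by fun_prop) continuous_const).1 hvol) s
    rw [one_mul] at this
    linarith
  refine ae_forall_eq_of_forall_ae_eq (fun o => by fun_prop) (fun _ => hcc) fun t => ?_
  have := ae_eq_integral_of_integral_norm_sq_le (hYm t) (hYb t) (by
    rw [← hinv t]; simp only [hYn]; exact (hall t).le)
  rwa [← hinv t] at this

/-- If the random affine map `x ↦ A x + B` with `A ≠ 0` and `E log |A| ≥ 0` has an invariant
probability measure, then it has a deterministic fixed point. -/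
theorem exists_fixedPoint_of_invariant (hA : Measurable A) (hB : Measurable B)
    (hne : ∀ᵐ o ∂P, A o ≠ 0) (hint : Integrable (fun o => Real.log |A o|) P)
    (hlog : 0 ≤ ∫ o, Real.log |A o| ∂P)
    (hν : (ν.prod P).map (fun p => A p.2 * p.1 + B p.2) = ν) :
    ∃ c : ℝ, ∀ᵐ o ∂P, A o * c + B o = c := by
  have hkey := ae_charFun_affine_eq hA hB hne hint hlog hν
  by_cases hnd : ∀ t, ‖charFun ν t‖ = 1
  · obtain ⟨c, hc⟩ := exists_charFun_eq_exp hnd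
    refine ⟨c, ?_⟩
    filter_upwards [hkey] with o ho
    refine eq_of_eventually_exp_eq (.of_forall fun t => ?_)
    have := ho t
    rw [hc, hc, ← Complex.exp_add] at this
    rw [← this]; congr 1; push_cast; ring
  have hev : ∀ᶠ t in 𝓝 (0 : ℝ), charFun ν t ≠ 0 :=
    continuous_charFun_real.continuousAt.eventually_ne (by simp)
  have hone : ∀ᵐ o ∂P, A o = 1 → B o = 0 := by
    filter_upwards [hkey] with o ho h1
    refine eq_of_eventually_exp_eq ?_
    filter_upwards [hev] with t ht
    have := ho t
    rw [h1, mul_one] at this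
    simpa using mul_right_cancel₀ ht (this.trans (one_mul _).symm)
  have habs : ∀ᵐ o ∂P, A o = 1 ∨ A o = -1 := by
    filter_upwards [hkey, hne] with o ho h0
    exact eq_or_eq_neg_of_abs_eq (abs_slope_eq_one_of_charFun_eq h0 ho hnd)
  -- Outside the point-mass case the maps are the identity or reflections. All reflections
  -- preserving `ν` have the same `B`, because `charFun ν` is nonzero near `0`; their centre `B / 2`
  -- is then fixed by every map.
  by_cases hneg : ∀ᵐ o ∂P, A o ≠ -1
  · refine ⟨0, ?_⟩
    filter_upwards [hone, habs, hneg] with o h1 h2 h3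
    simp [h1 (h2.resolve_right h3)]
  · obtain ⟨o', ho', hA'⟩ : ∃ o', (∀ t : ℝ, Complex.exp (t * B o' * Complex.I) *
        charFun ν (t * A o') = charFun ν t) ∧ A o' = -1 := by
      by_contra hcon
      push Not at hcon
      exact hneg (hkey.mono fun o ho => hcon o ho)
    refine ⟨B o' / 2, ?_⟩
    filter_upwards [hone, habs, hkey] with o h1 h2 h3
    rcases h2 with h2 | h2
    · rw [h1 h2, h2]; ring
    · have : B o = B o' := by
        refine eq_of_eventually_exp_eq ?_
        filter_upwards [hev] with t ht
        have e1 := h3 t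
        have e2 := ho' t
        rw [h2, mul_neg_one] at e1
        rw [hA', mul_neg_one] at e2
        refine mul_right_cancel₀ (b := charFun ν (-t)) ?_ (e1.trans e2.symm)
        rw [charFun_neg]
        simpa using ht
      rw [this, h2]; ring

end InvariantMeasure

/-! ### Vague limits and the time spent in compact sets -/

/-- Vague compactness of probability measures on the line. -/
theorem exists_vague_limit (μ : ℕ → Measure ℝ) [∀ n, IsProbabilityMeasure (μ n)]
    (U : Ultrafilter ℕ) :
    ∃ ν : Measure ℝ, IsFiniteMeasure ν ∧ ∀ f : ℝ → ℝ, Continuous f →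
      Tendsto f (cocompact ℝ) (𝓝 0) →
      Tendsto (fun n => ∫ x, f x ∂μ n) U (𝓝 (∫ x, f x ∂ν)) := by
  let : MeasurableSpace (OnePoint ℝ) := borel _
  have : BorelSpace (OnePoint ℝ) := ⟨rfl⟩
  have hemb : MeasurableEmbedding ((↑) : ℝ → OnePoint ℝ) :=
    OnePoint.isOpenEmbedding_coe.measurableEmbedding
  -- Probability measures on the one-point compactification form a compact space. Restricting the
  -- limit to `ℝ` discards the mass at infinity, so `ν` may even be zero.
  let p : ℕ → ProbabilityMeasure (OnePoint ℝ) := fun n =>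
    ⟨(μ n).map ((↑) : ℝ → OnePoint ℝ),
      Measure.isProbabilityMeasure_map hemb.measurable.aemeasurable⟩
  obtain ⟨ν', -, hν'⟩ :
      ∃ ν' : ProbabilityMeasure (OnePoint ℝ), ν' ∈ Set.univ ∧ ↑(U.map p) ≤ 𝓝 ν' :=
    isCompact_univ.ultrafilter_le_nhds (U.map p) (by simp)
  have hlim : Tendsto p U (𝓝 ν') := hν'
  rw [ProbabilityMeasure.tendsto_iff_forall_integral_tendsto] at hlim
  refine ⟨(ν' : Measure (OnePoint ℝ)).comap ((↑) : ℝ → OnePoint ℝ), ?_,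
    fun f hf h0 => ?_⟩
  · constructor
    rw [hemb.comap_apply]
    exact measure_lt_top _ _
  · let g : C(OnePoint ℝ, ℝ) := OnePoint.continuousMapMk ⟨f, hf⟩ 0 (by
      rwa [coclosedCompact_eq_cocompact])
    have hgf : ∀ x : ℝ, g x = f x := fun x => rfl
    have hginf : g OnePoint.infty = 0 := rfl
    have h := hlim (BoundedContinuousFunction.mkOfCompact g)
    simp only [BoundedContinuousFunction.mkOfCompact_apply] at h
    have e1 : ∀ n, ∫ x, g x ∂(p n : Measure (OnePoint ℝ)) = ∫ x, f x ∂μ n := fun n => by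
      change ∫ x, g x ∂((μ n).map ((↑) : ℝ → OnePoint ℝ)) = _
      rw [hemb.integral_map]
      rfl
    have e2 : ∫ x, g x ∂(ν' : Measure (OnePoint ℝ)) =
        ∫ x, f x ∂((ν' : Measure (OnePoint ℝ)).comap ((↑) : ℝ → OnePoint ℝ)) := by
      have : ∫ x, f x ∂((ν' : Measure (OnePoint ℝ)).comap ((↑) : ℝ → OnePoint ℝ)) =
          ∫ x, g x ∂(((ν' : Measure (OnePoint ℝ)).comap ((↑) : ℝ → OnePoint ℝ)).map
            ((↑) : ℝ → OnePoint ℝ)) := by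
        rw [hemb.integral_map]; rfl
      have hr : ∀ x ∉ Set.range ((↑) : ℝ → OnePoint ℝ), g x = 0 := fun x hx => by
        rw [← Set.mem_compl_iff, OnePoint.compl_range_coe] at hx
        rw [hx, hginf]
      rw [this, hemb.map_comap, setIntegral_eq_integral_of_forall_compl_eq_zero]
      exact hr
    simpa only [e1, e2] using h

section Cesaro

variable {Ω : Type*} [MeasurableSpace Ω] {P : Measure Ω} [IsProbabilityMeasure P] {A B : Ω → ℝ}

theorem exists_forall_norm_le_of_tendsto_cocompact {f : ℝ → ℝ} (hf : Continuous f)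
    (h0 : Tendsto f (cocompact ℝ) (𝓝 0)) : ∃ C, ∀ x, ‖f x‖ ≤ C := by
  let F : ZeroAtInftyContinuousMap ℝ ℝ := ⟨⟨f, hf⟩, h0⟩
  exact ⟨‖F.toBCF‖, fun x => F.toBCF.norm_coe_le_norm x⟩

variable (P A B) in
/-- The transition operator of the random affine recursion. -/
noncomputable def affineOp (f : ℝ → ℝ) (x : ℝ) : ℝ := ∫ o, f (A o * x + B o) ∂P

theorem continuous_affineOp (hA : Measurable A) (hB : Measurable B) {f : ℝ → ℝ}
    (hf : Continuous f) (h0 : Tendsto f (cocompact ℝ) (𝓝 0)) : Continuous (affineOp P A B f) := by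
  obtain ⟨C, hC⟩ := exists_forall_norm_le_of_tendsto_cocompact hf h0
  refine continuous_of_dominated (bound := fun _ => C) (fun x => ?_)
    (fun x => .of_forall fun o => hC _) (integrable_const _) (.of_forall fun o => by fun_prop)
  exact (hf.measurable.comp ((hA.mul_const x).add hB)).aestronglyMeasurable

/-- With slope nonzero, almost every map sends infinity to infinity. This makes `affineOp P A B f`
an admissible test function for vague limits. -/
theorem tendsto_affineOp_cocompact (hA : Measurable A) (hB : Measurable B)
    (hne : ∀ᵐ o ∂P, A o ≠ 0) {f : ℝ → ℝ} (hf : Continuous f)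
    (h0 : Tendsto f (cocompact ℝ) (𝓝 0)) :
    Tendsto (affineOp P A B f) (cocompact ℝ) (𝓝 0) := by
  obtain ⟨C, hC⟩ := exists_forall_norm_le_of_tendsto_cocompact hf h0
  have : (0 : ℝ) = ∫ o, (0 : ℝ) ∂P := by simp
  have hcg : (cocompact ℝ).IsCountablyGenerated := by
    rw [cocompact_eq_atBot_atTop]; infer_instance
  rw [this]
  refine tendsto_integral_filter_of_dominated_convergence (fun _ => C) (.of_forall fun x => ?_)
    (.of_forall fun x => .of_forall fun o => hC _) (integrable_const _) ?_
  · exact (hf.measurable.comp ((hA.mul_const x).add hB)).aestronglyMeasurable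
  · filter_upwards [hne] with o ho
    have : Tendsto (fun x : ℝ => A o * x + B o) (cocompact ℝ) (cocompact ℝ) :=
      (((Homeomorph.mulLeft₀ (A o) ho).trans
        (Homeomorph.addRight (B o))).isClosedEmbedding).tendsto_cocompact
    exact h0.comp this

theorem integral_map_affine (hA : Measurable A) (hB : Measurable B) (μ : Measure ℝ)
    [IsFiniteMeasure μ] {f : ℝ → ℝ} (hf : Continuous f) (h0 : Tendsto f (cocompact ℝ) (𝓝 0)) :
    ∫ x, f x ∂(μ.prod P).map (fun p => A p.2 * p.1 + B p.2) = ∫ x, affineOp P A B f x ∂μ := by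
  obtain ⟨C, hC⟩ := exists_forall_norm_le_of_tendsto_cocompact hf h0
  have hm : Measurable fun p : ℝ × Ω => A p.2 * p.1 + B p.2 := by fun_prop
  rw [integral_map hm.aemeasurable hf.aestronglyMeasurable, integral_prod]
  · rfl
  · exact Integrable.of_bound (hf.measurable.comp hm).aestronglyMeasurable C
      (.of_forall fun p => hC _)

/-- If the random affine map `x ↦ A x + B` with `A ≠ 0` and `E log |A| ≥ 0` has no deterministic
fixed point, then the corresponding Markov chain spends a negligible fraction of time in compact
sets. -/
theorem tendsto_cesaro_of_affine_recursion (hA : Measurable A) (hB : Measurable B)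
    (hne : ∀ᵐ o ∂P, A o ≠ 0) (hint : Integrable (fun o => Real.log |A o|) P)
    (hlog : 0 ≤ ∫ o, Real.log |A o| ∂P) (hfix : ¬ ∃ c : ℝ, ∀ᵐ o ∂P, A o * c + B o = c)
    (μ : ℕ → Measure ℝ) [∀ k, IsProbabilityMeasure (μ k)]
    (hμ : ∀ k, μ (k + 1) = ((μ k).prod P).map (fun p => A p.2 * p.1 + B p.2))
    {h : ℝ → ℝ} (hh : Continuous h) (hh0 : Tendsto h (cocompact ℝ) (𝓝 0)) :
    Tendsto (fun n : ℕ => (∑ k ∈ Finset.range n, ∫ x, h x ∂μ k) / n) atTop (𝓝 0) := by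
  -- Averaging `n + 1` laws makes every `m n` a probability measure, including `m 0`.
  let m : ℕ → Measure ℝ := fun n => ((n + 1 : ℕ) : ENNReal)⁻¹ • ∑ k ∈ Finset.range (n + 1), μ k
  have hm1 : ∀ n, IsProbabilityMeasure (m n) := fun n => ⟨by
    simp only [m, Measure.smul_apply, Measure.finsetSum_apply, measure_univ, Finset.sum_const,
      Finset.card_range, smul_eq_mul, nsmul_eq_mul, mul_one]
    exact ENNReal.inv_mul_cancel (by simp) (ENNReal.natCast_ne_top _)⟩
  have hmi : ∀ n (f : ℝ → ℝ), Continuous f → Tendsto f (cocompact ℝ) (𝓝 0) →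
      ∫ x, f x ∂m n = (∑ k ∈ Finset.range (n + 1), ∫ x, f x ∂μ k) / ((n + 1 : ℕ) : ℝ) := by
    intro n f hf h0
    obtain ⟨C, hC⟩ := exists_forall_norm_le_of_tendsto_cocompact hf h0
    simp only [m]
    rw [integral_smul_measure, integral_finsetSum_measure fun k _ =>
      Integrable.of_bound hf.aestronglyMeasurable C (.of_forall hC)]
    rw [ENNReal.toReal_inv, ENNReal.toReal_natCast, div_eq_inv_mul, smul_eq_mul]
  rw [← tendsto_add_atTop_iff_nat 1]
  simp_rw [← fun n => hmi n h hh hh0]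
  rw [tendsto_iff_ultrafilter]
  intro U hU
  obtain ⟨ν, hνfin, hν⟩ := exists_vague_limit m U
  have hlim := hν h hh hh0
  rcases eq_or_ne ν 0 with rfl | hν0
  · simpa using hlim
  exfalso
  apply hfix
  -- Krylov–Bogoliubov: one step of the chain changes the average only by two boundary terms divided
  -- by `n + 1`.
  have hinv : ∀ f : ℝ → ℝ, Continuous f → Tendsto f (cocompact ℝ) (𝓝 0) →
      ∫ x, affineOp P A B f x ∂ν = ∫ x, f x ∂ν := by
    intro f hf h0
    obtain ⟨C, hC⟩ := exists_forall_norm_le_of_tendsto_cocompact hf h0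
    have hC' : ∀ k, |∫ x, f x ∂μ k| ≤ C := fun k => by
      simpa using norm_integral_le_of_norm_le_const (μ := μ k) (.of_forall hC)
    have hcA := continuous_affineOp (P := P) hA hB hf h0
    have h0A := tendsto_affineOp_cocompact (P := P) hA hB hne hf h0
    have h1 := (hν _ hcA h0A).sub (hν f hf h0)
    have hdiff : ∀ n, ∫ x, affineOp P A B f x ∂m n - ∫ x, f x ∂m n =
        (∫ x, f x ∂μ (n + 1) - ∫ x, f x ∂μ 0) / ((n + 1 : ℕ) : ℝ) := fun n => by
      rw [hmi n _ hcA h0A, hmi n f hf h0, ← sub_div]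
      congr 1
      simp_rw [← integral_map_affine (P := P) hA hB (μ _) hf h0, ← hμ]
      rw [← Finset.sum_sub_distrib, Finset.sum_range_sub (fun k => ∫ x, f x ∂μ k)]
    simp_rw [hdiff] at h1
    have h2 : Tendsto (fun n : ℕ => (∫ x, f x ∂μ (n + 1) - ∫ x, f x ∂μ 0) / ((n + 1 : ℕ) : ℝ))
        atTop (𝓝 0) := by
      refine squeeze_zero_norm (a := fun n : ℕ => (2 * C) / ((n + 1 : ℕ) : ℝ)) (fun n => ?_) ?_
      · rw [norm_div, Real.norm_natCast]
        gcongr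
        refine (norm_sub_le _ _).trans ?_
        have := hC' (n + 1)
        have := hC' 0
        simp only [Real.norm_eq_abs]
        linarith
      · exact (tendsto_const_div_atTop_nhds_zero_nat (2 * C)).comp (tendsto_add_atTop_nat 1)
    exact sub_eq_zero.1 (tendsto_nhds_unique h1 (h2.mono_left hU))
  let ν₁ : Measure ℝ := (ν Set.univ)⁻¹ • ν
  have hprob : IsProbabilityMeasure ν₁ := by
    have : NeZero ν := ⟨hν0⟩
    exact isProbabilityMeasureSMul
  have hmapp : IsProbabilityMeasure ((ν₁.prod P).map (fun p => A p.2 * p.1 + B p.2)) :=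
    Measure.isProbabilityMeasure_map (by fun_prop)
  refine exists_fixedPoint_of_invariant (ν := ν₁) hA hB hne hint hlog ?_
  refine Measure.ext_of_integral_eq_on_compactlySupported fun f => ?_
  have hf0 : Tendsto f (cocompact ℝ) (𝓝 0) := f.hasCompactSupport.is_zero_at_infty
  have h1 := integral_map_affine (P := P) hA hB ν₁ f.continuous hf0
  have h2 := hinv f f.continuous hf0
  refine h1.trans ?_
  rw [integral_smul_measure, integral_smul_measure]
  exact congrArg _ h2

end Cesaro

/-! ### The autoregression as a random affine recursion -/

section RandomCoefficient

variable {Ω : Type*} [MeasurableSpace Ω] {P : Measure Ω} [IsProbabilityMeasure P]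
  {b e : ℕ → Ω → ℝ}

theorem measurable_natural_rcaProcess (φ x₀ : ℝ)
    (hZ : ∀ k, StronglyMeasurable fun o => (b k o, e k o)) (k : ℕ) :
    Measurable[Filtration.natural (fun k o => (b k o, e k o)) hZ k] (rcaProcess φ x₀ b e k) := by
  set F := Filtration.natural (fun k o => (b k o, e k o)) hZ
  induction k with
  | zero => exact @measurable_const _ _ _ (F 0) x₀
  | succ k ih =>
    have h1 : Measurable[F (k + 1)] (rcaProcess φ x₀ b e k) := ih.mono (F.mono k.le_succ) le_rfl
    have h2 : Measurable[F (k + 1)] fun o => (b (k + 1) o, e (k + 1) o) :=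
      (Filtration.stronglyAdapted_natural hZ (k + 1)).measurable
    have h3 : Measurable[F (k + 1)] (b (k + 1)) := measurable_fst.comp h2
    have h4 : Measurable[F (k + 1)] (e (k + 1)) := measurable_snd.comp h2
    exact ((h3.const_add φ).mul h1).add h4

theorem measurable_rcaProcess (φ x₀ : ℝ) (hb : ∀ k, Measurable (b k)) (he : ∀ k, Measurable (e k))
    (k : ℕ) : Measurable (rcaProcess φ x₀ b e k) := by
  induction k with
  | zero => exact measurable_const
  | succ k ih => exact (((hb (k + 1)).const_add φ).mul ih).add (he (k + 1))

theorem indepFun_rcaProcess {P : Measure Ω} (φ x₀ : ℝ)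
    (hb : ∀ k, Measurable (b k)) (he : ∀ k, Measurable (e k))
    (hindep : iIndepFun (fun (k : ℕ) (o : Ω) => (b k o, e k o)) P) (k : ℕ) :
    IndepFun (rcaProcess φ x₀ b e k) (fun o => (b (k + 1) o, e (k + 1) o)) P := by
  have hZ : ∀ k, StronglyMeasurable fun o => (b k o, e k o) := fun k =>
    ((hb k).prodMk (he k)).stronglyMeasurable
  rw [IndepFun_iff_Indep]
  exact indep_of_indep_of_le_left (hindep.indep_comap_natural_of_lt hZ k.lt_succ_self).symm
    (measurable_natural_rcaProcess φ x₀ hZ k).comap_le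

theorem map_rcaProcess_succ (φ x₀ : ℝ) (hb : ∀ k, Measurable (b k)) (he : ∀ k, Measurable (e k))
    (hindep : iIndepFun (fun (k : ℕ) (o : Ω) => (b k o, e k o)) P)
    (hident : ∀ k, IdentDistrib (fun o => (b k o, e k o)) (fun o => (b 0 o, e 0 o)) P P) (k : ℕ) :
    P.map (rcaProcess φ x₀ b e (k + 1)) =
      ((P.map (rcaProcess φ x₀ b e k)).prod P).map (fun p => (φ + b 0 p.2) * p.1 + e 0 p.2) := by
  have hX := measurable_rcaProcess φ x₀ hb he k
  have hZ : ∀ k, Measurable fun o => (b k o, e k o) := fun k => (hb k).prodMk (he k)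
  have hprod := (indepFun_iff_map_prod_eq_prod_map_map hX.aemeasurable
    (hZ (k + 1)).aemeasurable).1 (indepFun_rcaProcess φ x₀ hb he hindep k)
  have hg : Measurable fun q : ℝ × ℝ × ℝ => (φ + q.2.1) * q.1 + q.2.2 := by fun_prop
  have hpp : Measurable (Prod.map id fun o => (b 0 o, e 0 o) : ℝ × Ω → ℝ × ℝ × ℝ) :=
    measurable_id.prodMap (hZ 0)
  have h1 : P.map (rcaProcess φ x₀ b e (k + 1)) =
      (P.map (fun o => (rcaProcess φ x₀ b e k o, (b (k + 1) o, e (k + 1) o)))).map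
        (fun q : ℝ × ℝ × ℝ => (φ + q.2.1) * q.1 + q.2.2) := by
    rw [Measure.map_map hg (hX.prodMk (hZ (k + 1)))]; rfl
  have hprob : IsProbabilityMeasure (P.map (rcaProcess φ x₀ b e k)) :=
    Measure.isProbabilityMeasure_map hX.aemeasurable
  have h2 := Measure.map_prod_map (P.map (rcaProcess φ x₀ b e k)) P measurable_id (hZ 0)
  rw [h1, hprod, (hident (k + 1)).map_eq, ← Measure.map_id (μ := P.map (rcaProcess φ x₀ b e k)),
    h2, Measure.map_map hg hpp, Measure.map_id]
  rfl

/-- A fixed point `c` makes `e` an affine function of `b` with slope `-c`. The means remove the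
constant term, zero covariance forces `c = 0`, and then `e = 0` almost surely. -/
theorem not_exists_fixedPoint {φ ω σ : ℝ} {b e : Ω → ℝ}
    (hb2 : MemLp b 2 P) (hb_mean : ∫ o, b o ∂P = 0)
    (hb_var : ∫ o, b o ^ 2 ∂P = ω ^ 2) (hω : 0 < ω ^ 2)
    (he_mean : ∫ o, e o ∂P = 0)
    (he_var : ∫ o, e o ^ 2 ∂P = σ ^ 2) (hσ : 0 < σ ^ 2) (hcov : cov[b, e; P] = 0) :
    ¬ ∃ c : ℝ, ∀ᵐ o ∂P, (φ + b o) * c + e o = c := by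
  rintro ⟨c, hc⟩
  have hbi : Integrable b P := hb2.integrable one_le_two
  have hev : e =ᵐ[P] fun o => c * (1 - φ) - c * b o := by
    filter_upwards [hc] with o ho
    linarith
  have h1 : c * (1 - φ) = 0 := by
    have := integral_congr_ae hev
    rw [he_mean, integral_sub (integrable_const _) (hbi.const_mul c),
      integral_const_mul (μ := P) c b, hb_mean] at this
    simpa using this.symm
  have hev' : e =ᵐ[P] fun o => -c * b o := by
    filter_upwards [hev] with o ho
    rw [ho, h1]; ring
  have h2 : -c * ω ^ 2 = 0 := by
    rw [covariance, hb_mean, he_mean] at hcov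
    rw [← hb_var, ← integral_const_mul, ← hcov]
    refine integral_congr_ae ?_
    filter_upwards [hev'] with o ho
    rw [ho]; ring
  have hc0 : c = 0 := by simpa [hω.ne'] using h2
  have h3 : ∫ o, e o ^ 2 ∂P = 0 := by
    have : (fun o => e o ^ 2) =ᵐ[P] fun _ => 0 := by
      filter_upwards [hev'] with o ho
      rw [ho, hc0]; simp
    rw [integral_congr_ae this]; simp
  linarith

/-- The unstable random coefficient autoregression spends a negligible fraction of time in compact
sets. -/
theorem tendsto_cesaro_rcaProcess {φ ω σ : ℝ} (x₀ : ℝ)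
    (hb : ∀ k, Measurable (b k)) (he : ∀ k, Measurable (e k))
    (hindep : iIndepFun (fun (k : ℕ) (o : Ω) => (b k o, e k o)) P)
    (hident : ∀ k, IdentDistrib (fun o => (b k o, e k o)) (fun o => (b 0 o, e 0 o)) P P)
    (hb2 : MemLp (b 0) 2 P) (hb_mean : ∫ o, b 0 o ∂P = 0)
    (hb_var : ∫ o, b 0 o ^ 2 ∂P = ω ^ 2) (hω : 0 < ω ^ 2)
    (he_mean : ∫ o, e 0 o ∂P = 0)
    (he_var : ∫ o, e 0 o ^ 2 ∂P = σ ^ 2) (hσ : 0 < σ ^ 2)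
    (hcov : cov[b 0, e 0; P] = 0)
    (hne : ∀ᵐ o ∂P, φ + b 0 o ≠ 0)
    (hlog_int : Integrable (fun o => Real.log |φ + b 0 o|) P)
    (hlog : 0 ≤ ∫ o, Real.log |φ + b 0 o| ∂P)
    {h : ℝ → ℝ} (hh : Continuous h) (hh0 : Tendsto h (cocompact ℝ) (𝓝 0)) :
    Tendsto (fun n : ℕ => (∑ k ∈ Finset.range n, ∫ o, h (rcaProcess φ x₀ b e k o) ∂P) / n)
      atTop (𝓝 0) := by
  have hX := measurable_rcaProcess φ x₀ hb he
  have hprob : ∀ k, IsProbabilityMeasure (P.map (rcaProcess φ x₀ b e k)) := fun k =>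
    Measure.isProbabilityMeasure_map (hX k).aemeasurable
  have := tendsto_cesaro_of_affine_recursion (P := P) ((hb 0).const_add φ) (he 0) hne hlog_int hlog
    (not_exists_fixedPoint hb2 hb_mean hb_var hω he_mean he_var hσ hcov)
    (fun k => P.map (rcaProcess φ x₀ b e k))
    (map_rcaProcess_succ φ x₀ hb he hindep hident) hh hh0
  simpa only [integral_map (hX _).aemeasurable hh.aestronglyMeasurable] using this

end RandomCoefficient

/-! ### The limit contrast and the approximation of one likelihood term -/

section Contrast

/-- The limit, as the state grows, of the normalised quasi-likelihood contrast. -/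
noncomputable def limitContrast (φ τ : ℝ) (q : ℝ × ℝ) : ℝ :=
  Real.log q.2 + ((φ - q.1) ^ 2 + τ) / q.2

/-- For `x ≠ τ` this is `log u < u - 1` at `u = τ / x`; for `x = τ` the term in `φ - s` is strict.
-/
theorem limitContrast_lt {φ τ s x : ℝ} (hτ : 0 < τ) (hx : 0 < x) (hne : (s, x) ≠ (φ, τ)) :
    limitContrast φ τ (φ, τ) < limitContrast φ τ (s, x) := by
  simp only [limitContrast, sub_self]
  have hlog : Real.log (τ / x) = Real.log τ - Real.log x := Real.log_div hτ.ne' hx.ne'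
  have h1 : (0 ^ 2 + τ) / τ = 1 := by field_simp; ring
  rw [h1, add_div]
  by_cases hxt : x = τ
  · subst hxt
    have hs : φ - s ≠ 0 := fun h => hne (by rw [sub_eq_zero.1 h])
    have : 0 < (φ - s) ^ 2 / x := by positivity
    rw [div_self hx.ne']
    linarith
  · have h2 : τ / x ≠ 1 := fun h => hxt ((div_eq_one_iff_eq hx.ne').1 h).symm
    have := Real.log_lt_sub_one_of_pos (div_pos hτ hx) h2
    have : 0 ≤ (φ - s) ^ 2 / x := by positivity
    linarith

/-- Well-separation of the minimum, by compactness of `Γ` minus a ball. -/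
theorem exists_forall_dist_lt_of_limitContrast_le {φ τ : ℝ} (hτ : 0 < τ) {Γ : Set (ℝ × ℝ)}
    (hΓ : IsCompact Γ) (hpos : ∀ q ∈ Γ, 0 < q.2) {ε : ℝ} (hε : 0 < ε) :
    ∃ δ > 0, ∀ q ∈ Γ, limitContrast φ τ q ≤ limitContrast φ τ (φ, τ) + δ → dist q (φ, τ) < ε := by
  have hK : IsCompact (Γ \ Metric.ball (φ, τ) ε) := hΓ.diff Metric.isOpen_ball
  have hcont : ContinuousOn (limitContrast φ τ) (Γ \ Metric.ball (φ, τ) ε) := by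
    have hne : ∀ q ∈ Γ \ Metric.ball (φ, τ) ε, q.2 ≠ 0 := fun q hq => (hpos q hq.1).ne'
    unfold limitContrast
    exact (continuousOn_snd.log hne).add (ContinuousOn.div (by fun_prop) continuousOn_snd hne)
  rcases (Γ \ Metric.ball (φ, τ) ε).eq_empty_or_nonempty with hemp | hnon
  · refine ⟨1, one_pos, fun q hq _ => ?_⟩
    by_contra hcon
    exact Set.notMem_empty q (hemp ▸ ⟨hq, by simpa using hcon⟩)
  · obtain ⟨q₀, hq₀, hmin⟩ := hK.exists_isMinOn hnon hcont
    have hlt : limitContrast φ τ (φ, τ) < limitContrast φ τ q₀ := by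
      refine limitContrast_lt hτ (hpos _ hq₀.1) fun h => hq₀.2 ?_
      rw [show q₀ = (φ, τ) from h]
      exact Metric.mem_ball_self hε
    refine ⟨(limitContrast φ τ q₀ - limitContrast φ τ (φ, τ)) / 2, by linarith, fun q hq hle => ?_⟩
    by_contra hcon
    have := hmin (⟨hq, by simpa using hcon⟩ : q ∈ Γ \ Metric.ball (φ, τ) ε)
    simp only [Set.mem_ofPred_eq] at this
    linarith

theorem abs_log_sub_log_le {a b c : ℝ} (hc : 0 < c) (ha : c ≤ a) (hb : c ≤ b) :
    |Real.log a - Real.log b| ≤ |a - b| / c := by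
  have key : ∀ a b : ℝ, c ≤ a → c ≤ b → Real.log a - Real.log b ≤ |a - b| / c := by
    intro a b ha hb
    have ha0 := hc.trans_le ha
    have hb0 := hc.trans_le hb
    rw [← Real.log_div ha0.ne' hb0.ne']
    calc Real.log (a / b) ≤ a / b - 1 := Real.log_le_sub_one_of_pos (div_pos ha0 hb0)
      _ = (a - b) / b := by field_simp
      _ ≤ |a - b| / b := by gcongr; exact le_abs_self _
      _ ≤ |a - b| / c := by gcongr
  rw [abs_le]
  constructor
  · have := key b a hb ha
    rw [abs_sub_comm] at this
    linarith
  · exact key a b ha hb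

theorem one_add_abs_sq_le (v : ℝ) : (1 + |v|) ^ 2 ≤ 2 * (1 + v ^ 2) := by
  rw [← sq_abs v]; nlinarith [sq_nonneg (1 - |v|)]

/-- A term of the quasi-likelihood of the random coefficient autoregression, after removal of a
quantity that does not depend on the parameter, is close to its value at infinity when the state is
large, uniformly in the parameter. -/
theorem abs_qlTerm_sub_le {s₁ s₂ x₁ x₂ y φ : ℝ} (hx₁ : 0 < x₁) (hx : x₁ < x₂) (hy : 0 < y)
    (hφ : φ ∈ Set.Icc s₁ s₂) :
    ∃ C, 0 ≤ C ∧ ∀ s ∈ Set.Icc s₁ s₂, ∀ x ∈ Set.Icc x₁ x₂, ∀ v β ε : ℝ,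
      |-2 * qlTerm s x y v ((φ + β) * v + ε) - Real.log (1 + v ^ 2) -
        (Real.log x + (φ - s + β) ^ 2 / x)| ≤ C * ((1 + β ^ 2 + ε ^ 2) * (1 / (1 + |v|))) := by
  have hc : 0 < min x₁ y := lt_min hx₁ hy
  set c := min x₁ y with hcdef
  have hcx : c ≤ x₁ := min_le_left _ _
  have hcy : c ≤ y := min_le_right _ _
  have hx₂ : 0 < x₂ := hx₁.trans hx
  set K := s₂ - s₁
  -- The two summands bound the logarithmic and the quadratic error. The choice of `c` gives `x v² +
  -- y ≥ c (1 + v²)`, and `K` bounds `|φ - s|`.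
  refine ⟨2 * (x₂ + y) / c + 2 * (x₂ + y) * (2 * K ^ 2 + 2) / (x₁ * c), by positivity,
    fun s hs x hxm v β ε => ?_⟩
  have hx0 : 0 < x := hx₁.trans_le hxm.1
  have hv : 0 < 1 + |v| := by positivity
  have hv2 : 0 < 1 + v ^ 2 := by positivity
  set w := x * v ^ 2 + y with hw
  have hwc : c * (1 + v ^ 2) ≤ w := by
    have := mul_le_mul_of_nonneg_right (hcx.trans hxm.1) (sq_nonneg v)
    linarith
  have hw0 : 0 < w := lt_of_lt_of_le (by positivity) hwc
  have hxc : c * (1 + v ^ 2) ≤ x * (1 + v ^ 2) := by gcongr; exact hcx.trans hxm.1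
  have hsq := one_add_abs_sq_le v
  have hinv : 1 / (1 + v ^ 2) ≤ 2 / (1 + |v|) := by
    rw [div_le_div_iff₀ hv2 hv]
    nlinarith [abs_nonneg v]
  have hinv' : (1 + |v|) / (1 + v ^ 2) ≤ 2 / (1 + |v|) := by
    rw [div_le_div_iff₀ hv2 hv]
    nlinarith
  have hE : 1 ≤ 1 + β ^ 2 + ε ^ 2 := by nlinarith [sq_nonneg β, sq_nonneg ε]
  have hlog : |Real.log w - Real.log (1 + v ^ 2) - Real.log x| ≤
      2 * (x₂ + y) / c * ((1 + β ^ 2 + ε ^ 2) * (1 / (1 + |v|))) := by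
    have e1 : Real.log w - Real.log (1 + v ^ 2) - Real.log x =
        Real.log w - Real.log (x * (1 + v ^ 2)) := by
      rw [Real.log_mul hx0.ne' hv2.ne']; ring
    have e2 : |w - x * (1 + v ^ 2)| ≤ x₂ + y := by
      rw [show w - x * (1 + v ^ 2) = y - x by rw [hw]; ring, abs_le]
      constructor <;> linarith [hxm.2]
    rw [e1]
    calc _ ≤ |w - x * (1 + v ^ 2)| / (c * (1 + v ^ 2)) :=
          abs_log_sub_log_le (by positivity) hwc hxc
      _ ≤ (x₂ + y) / (c * (1 + v ^ 2)) := by gcongr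
      _ = (x₂ + y) / c * (1 / (1 + v ^ 2)) := by field_simp
      _ ≤ (x₂ + y) / c * (2 / (1 + |v|)) := by gcongr
      _ = 2 * (x₂ + y) / c * (1 * (1 / (1 + |v|))) := by ring
      _ ≤ _ := by gcongr
  have hquad : |((φ + β) * v + ε - s * v) ^ 2 / w - (φ - s + β) ^ 2 / x| ≤
      2 * (x₂ + y) * (2 * K ^ 2 + 2) / (x₁ * c) * ((1 + β ^ 2 + ε ^ 2) * (1 / (1 + |v|))) := by
    set γ := φ - s + β with hγ
    have hγ2 : γ ^ 2 ≤ 2 * K ^ 2 + 2 * β ^ 2 := by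
      have h1 : |φ - s| ≤ K := abs_le.2 ⟨by linarith [hφ.1, hs.2], by linarith [hφ.2, hs.1]⟩
      have h2 : (φ - s) ^ 2 ≤ K ^ 2 := sq_le_sq' (abs_le.1 h1).1 (abs_le.1 h1).2
      nlinarith [sq_nonneg (φ - s - β)]
    -- The `v²` terms cancel, so the numerator grows only linearly in `v` while `w` grows
    -- quadratically.
    have e1 : ((φ + β) * v + ε - s * v) ^ 2 / w - γ ^ 2 / x =
        (2 * x * γ * v * ε + x * ε ^ 2 - γ ^ 2 * y) / (x * w) := by
      rw [div_sub_div _ _ hw0.ne' hx0.ne', mul_comm w x]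
      congr 1
      rw [hw, hγ]; ring
    have e2 : |2 * x * γ * v * ε + x * ε ^ 2 - γ ^ 2 * y| ≤
        (x₂ + y) * (γ ^ 2 + ε ^ 2) * (1 + |v|) := by
      have a1 : |2 * x * γ * v * ε| ≤ x₂ * (γ ^ 2 + ε ^ 2) * |v| := by
        have : |2 * x * γ * v * ε| = x * (2 * |γ| * |ε|) * |v| := by
          rw [abs_mul, abs_mul, abs_mul, abs_mul, abs_two, abs_of_pos hx0]; ring
        rw [this]
        have : 2 * |γ| * |ε| ≤ γ ^ 2 + ε ^ 2 := by
          rw [← sq_abs γ, ← sq_abs ε]; exact two_mul_le_add_sq _ _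
        gcongr
        exact hxm.2
      have a2 : |x * ε ^ 2| ≤ x₂ * ε ^ 2 := by
        rw [abs_of_nonneg (by positivity)]; gcongr; exact hxm.2
      have a3 : |γ ^ 2 * y| = γ ^ 2 * y := abs_of_nonneg (by positivity)
      have a4 := abs_sub (2 * x * γ * v * ε + x * ε ^ 2) (γ ^ 2 * y)
      have a5 := abs_add_le (2 * x * γ * v * ε) (x * ε ^ 2)
      have b1 : 0 ≤ y * (γ ^ 2 + ε ^ 2) * |v| := by positivity
      have b2 : 0 ≤ x₂ * γ ^ 2 := by positivity
      have b3 : 0 ≤ y * ε ^ 2 := by positivity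
      have b4 : (x₂ + y) * (γ ^ 2 + ε ^ 2) * (1 + |v|) = x₂ * (γ ^ 2 + ε ^ 2) * |v| + x₂ * ε ^ 2 +
          γ ^ 2 * y + (y * (γ ^ 2 + ε ^ 2) * |v| + x₂ * γ ^ 2 + y * ε ^ 2) := by ring
      rw [a3] at a4
      linarith
    have e3 : γ ^ 2 + ε ^ 2 ≤ (2 * K ^ 2 + 2) * (1 + β ^ 2 + ε ^ 2) := by
      nlinarith [mul_nonneg (sq_nonneg K) (sq_nonneg β), mul_nonneg (sq_nonneg K) (sq_nonneg ε),
        sq_nonneg ε]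
    rw [e1, abs_div, abs_of_pos (mul_pos hx0 hw0)]
    calc _ ≤ (x₂ + y) * ((2 * K ^ 2 + 2) * (1 + β ^ 2 + ε ^ 2)) * (1 + |v|) /
          (x₁ * (c * (1 + v ^ 2))) := by
          gcongr
          · exact e2.trans (by gcongr)
          · exact hxm.1
      _ = (x₂ + y) * (2 * K ^ 2 + 2) / (x₁ * c) * (1 + β ^ 2 + ε ^ 2) *
          ((1 + |v|) / (1 + v ^ 2)) := by field_simp
      _ ≤ (x₂ + y) * (2 * K ^ 2 + 2) / (x₁ * c) * (1 + β ^ 2 + ε ^ 2) *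
          (2 / (1 + |v|)) := by gcongr
      _ = _ := by ring
  have hsplit : -2 * qlTerm s x y v ((φ + β) * v + ε) - Real.log (1 + v ^ 2) -
      (Real.log x + (φ - s + β) ^ 2 / x) =
      (Real.log w - Real.log (1 + v ^ 2) - Real.log x) +
      (((φ + β) * v + ε - s * v) ^ 2 / w - (φ - s + β) ^ 2 / x) := by
    rw [qlTerm]; ring
  rw [hsplit]
  exact (abs_add_le _ _).trans ((add_le_add hlog hquad).trans_eq (add_mul _ _ _).symm)

theorem tendsto_one_div_one_add_abs :
    Tendsto (fun v : ℝ => 1 / (1 + |v|)) (cocompact ℝ) (𝓝 0) := by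
  have : Tendsto (fun v : ℝ => 1 + |v|) (cocompact ℝ) atTop :=
    tendsto_atTop_add_const_left _ _ (tendsto_norm_cocompact_atTop (E := ℝ))
  exact this.inv_tendsto_atTop.congr fun v => (one_div _).symm

end Contrast

/-! ### Uniform convergence of the contrast and consistency -/

/-- The normalised quasi-likelihood is uniformly close to its limit contrast, up to a term that does
not depend on the parameter. -/
theorem abs_quasiLogLik_sub_limitContrast_le {s₁ s₂ x₁ x₂ y φ τ C : ℝ} (hx₁ : 0 < x₁)
    (hφ : φ ∈ Set.Icc s₁ s₂)
    (hC : ∀ s ∈ Set.Icc s₁ s₂, ∀ x ∈ Set.Icc x₁ x₂, ∀ v β ε : ℝ,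
      |-2 * qlTerm s x y v ((φ + β) * v + ε) - Real.log (1 + v ^ 2) -
        (Real.log x + (φ - s + β) ^ 2 / x)| ≤ C * ((1 + β ^ 2 + ε ^ 2) * (1 / (1 + |v|))))
    {X b e : ℕ → ℝ} (hX : ∀ k, X (k + 1) = (φ + b (k + 1)) * X k + e (k + 1))
    {n : ℕ} (hn : 0 < n) {q : ℝ × ℝ} (hq : q ∈ Set.Icc s₁ s₂ ×ˢ Set.Icc x₁ x₂) :
    |-2 * quasiLogLik X n q.1 q.2 y / n - (∑ k ∈ Finset.range n, Real.log (1 + X k ^ 2)) / n -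
      limitContrast φ τ q| ≤
      C * ((∑ k ∈ Finset.range n, (1 + b (k + 1) ^ 2 + e (k + 1) ^ 2) * (1 / (1 + |X k|))) / n) +
      (2 * (s₂ - s₁) * |(∑ k ∈ Finset.range n, b (k + 1)) / n| +
        |(∑ k ∈ Finset.range n, b (k + 1) ^ 2) / n - τ|) / x₁ := by
  obtain ⟨s, x⟩ := q
  have hs : s ∈ Set.Icc s₁ s₂ := hq.1
  have hx : x ∈ Set.Icc x₁ x₂ := hq.2
  have hx0 : 0 < x := hx₁.trans_le hx.1
  have hn0 : (0 : ℝ) < n := by exact_mod_cast hn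
  set t : ℕ → ℝ := fun k => -2 * qlTerm s x y (X k) (X (k + 1)) - Real.log (1 + X k ^ 2) -
    (Real.log x + (φ - s + b (k + 1)) ^ 2 / x) with ht
  have ht_le : |∑ k ∈ Finset.range n, t k| ≤ C * ∑ k ∈ Finset.range n,
      (1 + b (k + 1) ^ 2 + e (k + 1) ^ 2) * (1 / (1 + |X k|)) := by
    rw [Finset.mul_sum]
    refine (Finset.abs_sum_le_sum_abs _ _).trans (Finset.sum_le_sum fun k _ => ?_)
    simp only [ht, hX k]
    exact hC s hs x hx _ _ _
  have hsum : ∑ k ∈ Finset.range n, (Real.log x + (φ - s + b (k + 1)) ^ 2 / x) =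
      n * Real.log x + (n * (φ - s) ^ 2 + 2 * (φ - s) * ∑ k ∈ Finset.range n, b (k + 1) +
        ∑ k ∈ Finset.range n, b (k + 1) ^ 2) / x := by
    rw [Finset.sum_add_distrib, ← Finset.sum_div]
    simp_rw [add_sq (φ - s)]
    rw [Finset.sum_add_distrib, Finset.sum_add_distrib, ← Finset.mul_sum]
    simp
  have hdecomp : -2 * quasiLogLik X n s x y / n -
      (∑ k ∈ Finset.range n, Real.log (1 + X k ^ 2)) / n - limitContrast φ τ (s, x) =
      (∑ k ∈ Finset.range n, t k) / n +
      (2 * (φ - s) * ((∑ k ∈ Finset.range n, b (k + 1)) / n) +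
        ((∑ k ∈ Finset.range n, b (k + 1) ^ 2) / n - τ)) / x := by
    simp only [ht, Finset.sum_sub_distrib, hsum, limitContrast, quasiLogLik, ← Finset.mul_sum]
    field_simp
    ring
  have hK : |φ - s| ≤ s₂ - s₁ :=
    abs_le.2 ⟨by linarith [hφ.1, hs.2], by linarith [hφ.2, hs.1]⟩
  simp only
  rw [hdecomp]
  refine (abs_add_le _ _).trans (add_le_add ?_ ?_)
  · rw [abs_div, abs_of_pos hn0, ← mul_div_assoc]
    gcongr
  · rw [abs_div, abs_of_pos hx0]
    have hs₁₂ : 0 ≤ s₂ - s₁ := (abs_nonneg _).trans hK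
    refine div_le_div₀ (by positivity) ((abs_add_le _ _).trans ?_) hx₁ hx.1
    rw [abs_mul, abs_mul, abs_two]
    gcongr

/-- Nonnegative random variables with expectations tending to zero tend to zero in measure. -/
theorem tendstoInMeasure_of_tendsto_integral {Ω : Type*} [MeasurableSpace Ω] {P : Measure Ω}
    {f : ℕ → Ω → ℝ} (h0 : ∀ n o, 0 ≤ f n o) (hi : ∀ n, Integrable (f n) P)
    (h : Tendsto (fun n => ∫ o, f n o ∂P) atTop (𝓝 0)) :
    TendstoInMeasure P f atTop (fun _ => 0) := by
  refine tendstoInMeasure_of_tendsto_eLpNorm one_ne_zero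
    (fun n => (hi n).aestronglyMeasurable) aestronglyMeasurable_const ?_
  have : ∀ n, eLpNorm (f n - fun _ => 0) 1 P = ENNReal.ofReal (∫ o, f n o ∂P) := fun n => by
    rw [ofReal_integral_eq_lintegral_ofReal (hi n) (.of_forall (h0 n)),
      eLpNorm_one_eq_lintegral_enorm]
    refine lintegral_congr fun o => ?_
    simp [Real.enorm_of_nonneg (h0 n o)]
  simp_rw [this]
  simpa using ENNReal.tendsto_ofReal h

theorem theorem2p1 {Ω : Type*} [MeasurableSpace Ω] (P : Measure Ω) [IsProbabilityMeasure P]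
    (φ ω σ x₀ : ℝ) (b e : ℕ → Ω → ℝ)
    -- the random vectors `(b_k, e_k)` are independent and identically distributed
    (hb : ∀ k, Measurable (b k)) (he : ∀ k, Measurable (e k))
    (hindep : iIndepFun (fun (k : ℕ) (o : Ω) => (b k o, e k o)) P)
    (hident : ∀ k, IdentDistrib (fun o => (b k o, e k o)) (fun o => (b 0 o, e 0 o)) P P)
    -- `E b_0 = 0`, `E b_0² = ω² > 0`, `E e_0 = 0`, `E e_0² = σ² > 0`, `cov(b_0, e_0) = 0`
    (hb2 : MemLp (b 0) 2 P) (hb_mean : ∫ o, b 0 o ∂P = 0)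
    (hb_var : ∫ o, b 0 o ^ 2 ∂P = ω ^ 2) (hω : 0 < ω ^ 2)
    (he2 : MemLp (e 0) 2 P) (he_mean : ∫ o, e 0 o ∂P = 0)
    (he_var : ∫ o, e 0 o ^ 2 ∂P = σ ^ 2) (hσ : 0 < σ ^ 2)
    (hcov : cov[b 0, e 0; P] = 0)
    -- `E log |φ + b_0| ≥ 0` with `log 0 = -∞`; as `E log⁺ |φ + b_0| < ∞`, this says precisely:
    (hne : ∀ᵐ o ∂P, φ + b 0 o ≠ 0)
    (hlog_int : Integrable (fun o => Real.log |φ + b 0 o|) P)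
    (hlog : 0 ≤ ∫ o, Real.log |φ + b 0 o| ∂P)
    -- the compact parameter set `Γ = [s₁, s₂] × [x₁, x₂]`, which contains the true parameter
    (s₁ s₂ x₁ x₂ : ℝ) (hs : s₁ < s₂) (hx₁ : 0 < x₁) (hx : x₁ < x₂)
    (htrue : (φ, ω ^ 2) ∈ Set.Icc s₁ s₂ ×ˢ Set.Icc x₁ x₂) :
    ∀ y : ℝ, 0 < y → ∀ η : ℕ → Ω → ℝ × ℝ,
      (∀ n, ∀ᵐ o ∂P, IsQMLE (fun k => rcaProcess φ x₀ b e k o) n y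
        (Set.Icc s₁ s₂ ×ˢ Set.Icc x₁ x₂) (η n o)) →
      TendstoInMeasure P η atTop (fun _ => (φ, ω ^ 2)) := by
  intro y hy η hη
  have hφ : φ ∈ Set.Icc s₁ s₂ := htrue.1
  obtain ⟨C, hC0, hC⟩ := abs_qlTerm_sub_le hx₁ hx hy hφ
  set X := rcaProcess φ x₀ b e with hXdef
  have hXm : ∀ k, Measurable (X k) := measurable_rcaProcess φ x₀ hb he
  have hh : Continuous fun v : ℝ => 1 / (1 + |v|) :=
    continuous_const.div (by fun_prop) fun v => by positivity
  have hces := tendsto_cesaro_rcaProcess x₀ hb he hindep hident hb2 hb_mean hb_var hω he_mean he_var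
    hσ hcov hne hlog_int hlog hh tendsto_one_div_one_add_abs
  rw [← hXdef] at hces
  -- the remainder coming from the visits of the process to bounded sets
  have hWm : Measurable fun p : ℝ × ℝ => 1 + p.1 ^ 2 + p.2 ^ 2 := by fun_prop
  have hW0 : Integrable (fun o => 1 + b 0 o ^ 2 + e 0 o ^ 2) P :=
    ((integrable_const _).add hb2.integrable_sq).add he2.integrable_sq
  have hWid : ∀ k, IdentDistrib (fun o => 1 + b k o ^ 2 + e k o ^ 2)
      (fun o => 1 + b 0 o ^ 2 + e 0 o ^ 2) P P := fun k => (hident k).comp hWm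
  have hWi : ∀ k, Integrable (fun o => 1 + b k o ^ 2 + e k o ^ 2) P := fun k =>
    (hWid k).integrable_iff.2 hW0
  have hhi : ∀ k, Integrable (fun o => 1 / (1 + |X k o|)) P := fun k =>
    Integrable.of_bound (hh.measurable.comp (hXm k)).aestronglyMeasurable 1 (.of_forall fun o => by
      rw [Real.norm_of_nonneg (by positivity)]
      exact div_le_one_of_le₀ (by linarith [abs_nonneg (X k o)]) (by positivity))
  -- The state `X k` is independent of the next innovation, so expectations factor and `D` inherits
  -- the Cesàro limit.
  have hind : ∀ k, IndepFun (fun o => 1 + b (k + 1) o ^ 2 + e (k + 1) o ^ 2)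
      (fun o => 1 / (1 + |X k o|)) P := fun k =>
    (indepFun_rcaProcess φ x₀ hb he hindep k).symm.comp hWm hh.measurable
  have hti : ∀ k, Integrable
      (fun o => (1 + b (k + 1) o ^ 2 + e (k + 1) o ^ 2) * (1 / (1 + |X k o|))) P := fun k =>
    (hind k).integrable_mul (hWi _) (hhi k)
  have hte : ∀ k, ∫ o, (1 + b (k + 1) o ^ 2 + e (k + 1) o ^ 2) * (1 / (1 + |X k o|)) ∂P =
      (∫ o, (1 + b 0 o ^ 2 + e 0 o ^ 2) ∂P) * ∫ o, 1 / (1 + |X k o|) ∂P := fun k => by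
    rw [(hind k).integral_fun_mul_eq_mul_integral (hWi _).aestronglyMeasurable
      (hhi k).aestronglyMeasurable, (hWid (k + 1)).integral_eq]
  set D : ℕ → Ω → ℝ := fun n o =>
    (∑ k ∈ Finset.range n, (1 + b (k + 1) o ^ 2 + e (k + 1) o ^ 2) * (1 / (1 + |X k o|))) / n
    with hD
  have hDlim : TendstoInMeasure P D atTop fun _ => 0 := by
    refine tendstoInMeasure_of_tendsto_integral (fun n o => by positivity)
      (fun n => (integrable_finsetSum _ fun k _ => hti k).div_const _) ?_
    have : ∀ n, ∫ o, D n o ∂P = (∫ o, (1 + b 0 o ^ 2 + e 0 o ^ 2) ∂P) *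
        ((∑ k ∈ Finset.range n, ∫ o, 1 / (1 + |X k o|) ∂P) / n) := fun n => by
      simp only [hD]
      rw [integral_div, integral_finsetSum _ fun k _ => hti k]
      simp_rw [hte]
      rw [← Finset.mul_sum, mul_div_assoc]
    simp_rw [this]
    simpa using hces.const_mul (∫ o, (1 + b 0 o ^ 2 + e 0 o ^ 2) ∂P)
  -- the remainder coming from the law of large numbers
  have hslln : ∀ f : ℝ → ℝ, Measurable f → Integrable (fun o => f (b 0 o)) P →
      ∀ᵐ o ∂P, Tendsto (fun n : ℕ => (∑ k ∈ Finset.range n, f (b (k + 1) o)) / n) atTop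
        (𝓝 (∫ o, f (b 0 o) ∂P)) := by
    intro f hf hfi
    have hid : ∀ k, IdentDistrib (fun o => f (b k o)) (fun o => f (b 0 o)) P P := fun k =>
      (hident k).comp (hf.comp measurable_fst)
    have := strong_law_ae_real (fun k o => f (b (k + 1) o)) ((hid 1).integrable_iff.2 hfi)
      (fun i j hij => (hindep.indepFun (Nat.succ_injective.ne hij)).comp (hf.comp measurable_fst)
        (hf.comp measurable_fst)) (fun k => (hid (k + 1)).trans (hid 1).symm)
    rwa [(hid (0 + 1)).integral_eq] at this
  set T : ℕ → Ω → ℝ := fun n o =>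
    (2 * (s₂ - s₁) * |(∑ k ∈ Finset.range n, b (k + 1) o) / n| +
      |(∑ k ∈ Finset.range n, b (k + 1) o ^ 2) / n - ω ^ 2|) / x₁ with hT
  have hTlim : TendstoInMeasure P T atTop fun _ => 0 := by
    refine tendstoInMeasure_of_tendsto_ae (fun n => ?_) ?_
    · exact Measurable.aestronglyMeasurable (by fun_prop)
    · filter_upwards [hslln id measurable_id (hb2.integrable one_le_two),
        hslln (fun z => z ^ 2) (by fun_prop) hb2.integrable_sq] with o h1 h2
      simp only [id_eq, hb_mean] at h1
      rw [hb_var] at h2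
      have := ((h1.abs.const_mul (2 * (s₂ - s₁))).add (h2.sub_const (ω ^ 2)).abs).div_const x₁
      simpa using this
  rw [tendstoInMeasure_iff_dist]
  intro ε hε
  obtain ⟨δ, hδ, hsep⟩ := exists_forall_dist_lt_of_limitContrast_le (φ := φ) (τ := ω ^ 2) hω
    ((isCompact_Icc (a := s₁) (b := s₂)).prod (isCompact_Icc (a := x₁) (b := x₂)))
    (fun q hq => hx₁.trans_le hq.2.1) hε
  rw [tendstoInMeasure_iff_dist] at hDlim hTlim
  -- Off the two exceptional events `C * D + T ≤ δ / 2`. This bound is used at the estimator and at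
  -- the true parameter, for a total of `δ`; `C + 1` avoids division by zero.
  have hDε := hDlim (δ / (4 * (C + 1))) (by positivity)
  have hTε := hTlim (δ / 4) (by positivity)
  refine tendsto_of_tendsto_of_tendsto_of_le_of_le' tendsto_const_nhds
    (by simpa using hDε.add hTε) (.of_forall fun _ => zero_le) ?_
  filter_upwards [eventually_gt_atTop 0] with n hn
  refine (measure_mono_ae ?_).trans (measure_union_le _ _)
  filter_upwards [hη n] with o ho hfar
  by_contra hcon
  have hcon' : ¬ (δ / (4 * (C + 1)) ≤ |D n o| ∨ δ / 4 ≤ |T n o|) := hcon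
  push Not at hcon'
  obtain ⟨hDn, hTn⟩ := hcon'
  have hfar' : ε ≤ dist (η n o) (φ, ω ^ 2) := hfar
  refine hfar'.not_gt (hsep _ ho.1 ?_)
  have hbd := fun q hq => abs_quasiLogLik_sub_limitContrast_le (τ := ω ^ 2) hx₁ hφ hC
    (X := fun k => X k o) (b := fun k => b k o) (e := fun k => e k o) (fun k => rfl) hn (q := q) hq
  have hsmall : C * D n o + T n o ≤ δ / 2 := by
    have h1 := (le_abs_self _).trans hDn.le
    have h2 := (le_abs_self _).trans hTn.le
    have h3 : C * D n o ≤ C * (δ / (4 * (C + 1))) := by gcongr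
    have h4 : C * (δ / (4 * (C + 1))) ≤ δ / 4 := by
      rw [← mul_div_assoc, div_le_div_iff₀ (by positivity) (by positivity)]
      nlinarith
    linarith
  -- The average of `log (1 + X_k²)` is the same in both bounds and cancels in the comparison.
  have hb1 := (abs_le.1 ((hbd _ ho.1).trans hsmall)).1
  have hb2' := (abs_le.1 ((hbd _ htrue).trans hsmall)).2
  have hmax : quasiLogLik (fun k => X k o) n φ (ω ^ 2) y ≤
      quasiLogLik (fun k => X k o) n (η n o).1 (η n o).2 y := ho.2 htrue
  have hmax' : -2 * quasiLogLik (fun k => X k o) n (η n o).1 (η n o).2 y / n ≤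
      -2 * quasiLogLik (fun k => X k o) n φ (ω ^ 2) y / n := by
    have : (0 : ℝ) < n := by exact_mod_cast hn
    gcongr ?_ / _
    linarith
  simp only at hb1 hb2'
  linarith
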